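/- Let $n\ge 3$. Let $M$ be one of the following two monoids, with generating set $\Sigma$ and distinguished element $\Delta$: (a) the monoid of positive braids $B_n^+$, generated by $\Sigma=\{\sigma_1,\dots,\sigma_{n-1}\}$ subject to $\sigma_i\sigma_j=\sigma_j\sigma_i$ for $|i-j|\ge 2$ and $\sigma_i\sigma_j\sigma_i=\sigma_j\sigma_i\sigma_j$ for $|i-j|=1$, with $\Delta=(\sigma_1\cdots\sigma_{n-1})(\sigma_1\cdots\sigma_{n-2})\cdots(\sigma_1\sigma_2)\sigma_1$; (b) the dual braid monoid (Birman–Ko–Lee monoid) $B_n^{+*}$, generated by $\Sigma=\{\sigma_{i,j} : 1\le i<j\le n\}$ subject to, with the convention $\sigma_{j,i}=\sigma_{i,j}$, the relations $\sigma_{i,j}\sigma_{j,k}=\sigma_{j,k}\sigma_{k,i}=\sigma_{k,i}\sigma_{i,j}$ for $i<j<k$, and $\sigma_{i,j}\sigma_{k,\ell}=\sigma_{k,\ell}\sigma_{i,j}$ for $i<j<k<\ell$ and for $i<k<\ell<j$, with $\Delta=\sigma_{1,2}\sigma_{2,3}\cdots\sigma_{n-1,n}$. Let $\mathcal S=\{x\in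 M : \exists z\in M,\ \Delta=xz\}$ be the set of simple elements. For $x,y\in\mathcal S$ put $\mathsf R(x)=\{\sigma\in\Sigma : x\sigma\notin\mathcal S\}$ and $\mathsf L(y)=\{\sigma\in\Sigma : \exists z\in M,\ y=\sigma z\}$. The Charney graph of $M$ is the directed graph with vertex set $\mathcal S\setminus\{\mathbf e,\Delta\}$, where $\mathbf e$ is the unit of $M$, and with an edge $x\to y$ whenever $\mathsf R(x)\supseteq\mathsf L(y)$. Then, in both cases (a) and (b), the Charney graph of $M$ is strongly connected (for all vertices $x,y$ there is a directed path from $x$ to $y$) and contains loops (there is a vertex $x$ with $x\to x$). -/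

import Mathlib

/-- Relations of the monoid of positive braids on `n` strands. The index `i : Fin (n - 1)` stands
for the Artin generator `σ_{i+1}`. -/
inductive BraidRel (n : ℕ) : FreeMonoid (Fin (n - 1)) → FreeMonoid (Fin (n - 1)) → Prop
  | comm (i j : Fin (n - 1)) (h : (i : ℕ) + 2 ≤ j) :
      BraidRel n (FreeMonoid.of i * FreeMonoid.of j) (FreeMonoid.of j * FreeMonoid.of i)
  | braid (i j : Fin (n - 1)) (h : (i : ℕ) + 1 = j) :
      BraidRel n (FreeMonoid.of i * FreeMonoid.of j * FreeMonoid.of i)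
        (FreeMonoid.of j * FreeMonoid.of i * FreeMonoid.of j)

/-- The monoid `B_n^+` of positive braids on `n` strands. -/
abbrev PositiveBraid (n : ℕ) : Type := PresentedMonoid (BraidRel n)

/-- The set of Artin generators of `B_n^+`. -/
def PositiveBraid.generators (n : ℕ) : Set (PositiveBraid n) :=
  Set.range (PresentedMonoid.of (BraidRel n))

/-- `Δ_n = (σ_1 ⋯ σ_{n-1}) (σ_1 ⋯ σ_{n-2}) ⋯ (σ_1 σ_2) σ_1`. -/
def PositiveBraid.Delta (n : ℕ) : PositiveBraid n :=
  ((List.finRange (n - 1)).reverse.map fun k =>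
    (((List.finRange (n - 1)).filter (· ≤ k)).map (PresentedMonoid.of (BraidRel n))).prod).prod

/-- Index set of the Birman-Ko-Lee generators: pairs `i < j` of elements of `Fin n`, where
`i : Fin n` stands for the strand `i + 1`. -/
abbrev DualIndex (n : ℕ) : Type := {p : Fin n × Fin n // p.1 < p.2}

/-- The letter `σ_{i,j}`, for `i < j`. -/
def DualIndex.letter {n : ℕ} (i j : Fin n) (h : i < j) : FreeMonoid (DualIndex n) :=
  FreeMonoid.of ⟨(i, j), h⟩

/-- Relations of the dual braid monoid on `n` strands. The first two constructors encode
`σ_{i,j} σ_{j,k} = σ_{j,k} σ_{k,i} = σ_{k,i} σ_{i,j}` with the convention `σ_{k,i} = σ_{i,k}`. -/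
inductive DualBraidRel (n : ℕ) : FreeMonoid (DualIndex n) → FreeMonoid (DualIndex n) → Prop
  | triangle₁ (i j k : Fin n) (hij : i < j) (hjk : j < k) :
      DualBraidRel n (DualIndex.letter i j hij * DualIndex.letter j k hjk)
        (DualIndex.letter j k hjk * DualIndex.letter i k (hij.trans hjk))
  | triangle₂ (i j k : Fin n) (hij : i < j) (hjk : j < k) :
      DualBraidRel n (DualIndex.letter j k hjk * DualIndex.letter i k (hij.trans hjk))
        (DualIndex.letter i k (hij.trans hjk) * DualIndex.letter i j hij)
  | disjoint (i j k l : Fin n) (hij : i < j) (hjk : j < k) (hkl : k < l) :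
      DualBraidRel n (DualIndex.letter i j hij * DualIndex.letter k l hkl)
        (DualIndex.letter k l hkl * DualIndex.letter i j hij)
  | nested (i k l j : Fin n) (hik : i < k) (hkl : k < l) (hlj : l < j) :
      DualBraidRel n
        (DualIndex.letter i j (hik.trans (hkl.trans hlj)) * DualIndex.letter k l hkl)
        (DualIndex.letter k l hkl * DualIndex.letter i j (hik.trans (hkl.trans hlj)))

/-- The positive dual braid monoid `B_n^{+*}` (Birman-Ko-Lee monoid) on `n` strands. -/
abbrev DualBraid (n : ℕ) : Type := PresentedMonoid (DualBraidRel n)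

/-- The set of Birman-Ko-Lee generators of the dual braid monoid. -/
def DualBraid.generators (n : ℕ) : Set (DualBraid n) :=
  Set.range (PresentedMonoid.of (DualBraidRel n))

/-- The index `(i, i + 1)` of the generator `σ_{i,i+1}`. -/
def DualIndex.consecutive {n : ℕ} (i : Fin (n - 1)) : DualIndex n :=
  ⟨(⟨i, by omega⟩, ⟨i + 1, by omega⟩), Fin.mk_lt_mk.mpr (Nat.lt_succ_self _)⟩

/-- `δ_n = σ_{1,2} σ_{2,3} ⋯ σ_{n-1,n}`. -/
def DualBraid.delta (n : ℕ) : DualBraid n :=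
  ((List.finRange (n - 1)).map fun i =>
    PresentedMonoid.of (DualBraidRel n) (DualIndex.consecutive i)).prod

namespace Garside

/-- Left divisibility in a monoid. -/
def LeftDvd {M : Type*} [Monoid M] (x y : M) : Prop := ∃ z, y = x * z

/-- The simple elements: the divisors of `Δ`. (Left and right divisors of a Garside element
coincide; left divisors are used here.) -/
def simples {M : Type*} [Monoid M] (Δ : M) : Set M := {x | LeftDvd x Δ}

/-- `R(x) = {σ ∈ S : x σ is not simple}`, where `S` is the set of generators. -/
def R {M : Type*} [Monoid M] (S : Set M) (Δ x : M) : Set M := {σ ∈ S | x * σ ∉ simples Δ}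

/-- `L(y) = {σ ∈ S : σ left-divides y}`, where `S` is the set of generators. -/
def L {M : Type*} [Monoid M] (S : Set M) (y : M) : Set M := {σ ∈ S | LeftDvd σ y}

/-- The Charney graph: the vertices are the simple elements other than the unit and `Δ`, and
there is an edge `x → y` when `R(x) ⊇ L(y)`. -/
def charneyGraph {M : Type*} [Monoid M] (S : Set M) (Δ : M) :
    Digraph {x : M // x ∈ simples Δ \ {1, Δ}} where
  Adj x y := L S y.1 ⊆ R S Δ x.1

end Garside

/-- Every vertex can be reached from every vertex along a directed path. -/
def Digraph.StronglyConnected {V : Type*} (G : Digraph V) : Prop :=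
  ∀ x y : V, Relation.ReflTransGen G.Adj x y

/-- There is a vertex with an edge to itself. -/
def Digraph.HasLoop {V : Type*} (G : Digraph V) : Prop := ∃ x : V, G.Adj x x

/-- The Charney graph of `B_n^+`. -/
def PositiveBraid.charneyGraph (n : ℕ) :=
  Garside.charneyGraph (PositiveBraid.generators n) (PositiveBraid.Delta n)

/-- The Charney graph of the dual braid monoid. -/
def DualBraid.charneyGraph (n : ℕ) :=
  Garside.charneyGraph (DualBraid.generators n) (DualBraid.delta n)

namespace BraidPerm

variable {n : ℕ}

/-- The position `i`, for an adjacent pair `i, i + 1` of elements of `Fin n`. -/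
def lo (i : Fin (n - 1)) : Fin n := ⟨i, by omega⟩

/-- The position `i + 1`, for an adjacent pair `i, i + 1` of elements of `Fin n`. -/
def hi (i : Fin (n - 1)) : Fin n := ⟨i + 1, by omega⟩

@[simp] theorem val_lo (i : Fin (n - 1)) : (lo i : ℕ) = i := rfl

@[simp] theorem val_hi (i : Fin (n - 1)) : (hi i : ℕ) = i + 1 := rfl

theorem lo_lt_hi (i : Fin (n - 1)) : lo i < hi i := Fin.lt_def.mpr (Nat.lt_succ_self _)

/-- The adjacent transposition exchanging `i` and `i + 1`. -/
def adjSwap (i : Fin (n - 1)) : Equiv.Perm (Fin n) := Equiv.swap (lo i) (hi i)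

theorem val_adjSwap (i : Fin (n - 1)) (a : Fin n) :
    (adjSwap i a : ℕ) =
      if (a : ℕ) = i then (i : ℕ) + 1 else if (a : ℕ) = i + 1 then (i : ℕ) else a := by
  unfold adjSwap
  rw [Equiv.swap_apply_def]
  simp only [Fin.ext_iff, val_lo, val_hi]
  split_ifs <;> simp

@[simp] theorem adjSwap_lo (i : Fin (n - 1)) : adjSwap i (lo i) = hi i := Equiv.swap_apply_left _ _

@[simp] theorem adjSwap_hi (i : Fin (n - 1)) : adjSwap i (hi i) = lo i := Equiv.swap_apply_right _ _

@[simp] theorem adjSwap_mul_self (i : Fin (n - 1)) : adjSwap i * adjSwap i = 1 :=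
  Equiv.swap_mul_self _ _

@[simp] theorem adjSwap_inv (i : Fin (n - 1)) : (adjSwap i)⁻¹ = adjSwap i :=
  Equiv.swap_inv _ _

@[simp] theorem adjSwap_adjSwap (i : Fin (n - 1)) (a : Fin n) : adjSwap i (adjSwap i a) = a :=
  Equiv.swap_apply_self _ _ _

theorem adjSwap_comm (i j : Fin (n - 1)) (h : (i : ℕ) + 2 ≤ j) :
    adjSwap i * adjSwap j = adjSwap j * adjSwap i := by
  ext a
  simp only [Equiv.Perm.mul_apply, val_adjSwap]
  split_ifs <;> omega

theorem adjSwap_braid (i j : Fin (n - 1)) (h : (i : ℕ) + 1 = j) :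
    adjSwap i * adjSwap j * adjSwap i = adjSwap j * adjSwap i * adjSwap j := by
  have hij : lo j = hi i := Fin.ext h.symm
  have h1 : lo i ≠ hi i := (lo_lt_hi i).ne
  have h2 : hi i ≠ hi j := hij ▸ (lo_lt_hi j).ne
  have h3 : lo i ≠ hi j := ((lo_lt_hi i).trans (hij ▸ lo_lt_hi j)).ne
  simp only [adjSwap, hij]
  have e := Equiv.swap_mul_swap_mul_swap h2.symm h3.symm
  rw [Equiv.swap_comm (hi i) (lo i), Equiv.swap_comm (hi j) (hi i)] at e
  rw [e, Equiv.swap_mul_swap_mul_swap h1 h3, Equiv.swap_comm]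

/-- The inversions of a permutation. -/
def inversions (w : Equiv.Perm (Fin n)) : Finset (Fin n × Fin n) :=
  Finset.univ.filter fun p => p.1 < p.2 ∧ w p.2 < w p.1

theorem mem_inversions {w : Equiv.Perm (Fin n)} {a b : Fin n} :
    (a, b) ∈ inversions w ↔ a < b ∧ w b < w a := by
  simp [inversions]

/-- The number of inversions of a permutation. -/
def inv (w : Equiv.Perm (Fin n)) : ℕ := (inversions w).card

/-- `i` is a right descent of `w`. -/
def Descent (w : Equiv.Perm (Fin n)) (i : Fin (n - 1)) : Prop := w (hi i) < w (lo i)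

theorem not_descent_iff {w : Equiv.Perm (Fin n)} {i : Fin (n - 1)} :
    ¬ Descent w i ↔ w (lo i) < w (hi i) := by
  have : w (lo i) ≠ w (hi i) := fun h => (lo_lt_hi i).ne (w.injective h)
  unfold Descent
  rw [not_lt, le_iff_lt_or_eq]
  tauto

theorem descent_mul_adjSwap {w : Equiv.Perm (Fin n)} {i : Fin (n - 1)} :
    Descent (w * adjSwap i) i ↔ ¬ Descent w i := by
  rw [not_descent_iff]; simp [Descent]

theorem inv_mul_adjSwap_of_not_descent {w : Equiv.Perm (Fin n)} {i : Fin (n - 1)}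
    (h : ¬ Descent w i) : inv (w * adjSwap i) = inv w + 1 := by
  have hinj : Function.Injective (Prod.map (adjSwap i) (adjSwap i)) :=
    (adjSwap i).injective.prodMap (adjSwap i).injective
  rw [not_descent_iff] at h
  have key : inversions (w * adjSwap i) =
      insert (lo i, hi i) ((inversions w).image (Prod.map (adjSwap i) (adjSwap i))) := by
    ext ⟨a, b⟩
    simp only [mem_inversions, Finset.mem_insert, Finset.mem_image, Prod.exists, Prod.map_apply,
      Prod.mk.injEq, Equiv.Perm.mul_apply]
    constructor
    · rintro ⟨hab, hw⟩
      by_cases hc : a = lo i ∧ b = hi i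
      · exact Or.inl hc
      · refine Or.inr ⟨adjSwap i a, adjSwap i b, ⟨?_, hw⟩, by simp, by simp⟩
        have := val_adjSwap i a
        have := val_adjSwap i b
        simp only [Fin.ext_iff, val_lo, val_hi, Fin.lt_def] at *
        split_ifs at * <;> omega
    · rintro (⟨rfl, rfl⟩ | ⟨a', b', ⟨hab, hw⟩, rfl, rfl⟩)
      · simpa using ⟨lo_lt_hi i, h⟩
      · refine ⟨?_, by simpa using hw⟩
        have hc : ¬ (a' = lo i ∧ b' = hi i) := by
          rintro ⟨rfl, rfl⟩
          exact lt_asymm h hw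
        have := val_adjSwap i a'
        have := val_adjSwap i b'
        simp only [Fin.ext_iff, val_lo, val_hi, Fin.lt_def] at *
        split_ifs at * <;> omega
  rw [inv, key, Finset.card_insert_of_notMem, Finset.card_image_of_injective _ hinj, inv]
  simp only [mem_inversions, Finset.mem_image, Prod.exists, Prod.map_apply,
    Prod.mk.injEq, not_exists, not_and]
  rintro a b ⟨hab, -⟩ ha hb
  rw [← adjSwap_adjSwap i a, ← adjSwap_adjSwap i b, ha, hb] at hab
  simp only [adjSwap_lo, adjSwap_hi] at hab
  exact lt_asymm hab (lo_lt_hi i)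

theorem inv_mul_adjSwap_of_descent {w : Equiv.Perm (Fin n)} {i : Fin (n - 1)}
    (h : Descent w i) : inv (w * adjSwap i) + 1 = inv w := by
  have h' : ¬ Descent (w * adjSwap i) i := by rwa [descent_mul_adjSwap, not_not]
  have := inv_mul_adjSwap_of_not_descent h'
  rw [mul_assoc, adjSwap_mul_self, mul_one] at this
  exact this.symm

theorem inv_mul_adjSwap_le (w : Equiv.Perm (Fin n)) (i : Fin (n - 1)) :
    inv (w * adjSwap i) ≤ inv w + 1 := by
  by_cases h : Descent w i
  · have := inv_mul_adjSwap_of_descent h; omega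
  · exact (inv_mul_adjSwap_of_not_descent h).le

theorem inv_inv (w : Equiv.Perm (Fin n)) : inv w⁻¹ = inv w := by
  refine Finset.card_bij' (fun p _ => (w⁻¹ p.2, w⁻¹ p.1)) (fun p _ => (w p.2, w p.1)) ?_ ?_ ?_ ?_ <;>
  · rintro ⟨a, b⟩ h
    simp_all [inversions]

@[simp] theorem inv_one : inv (1 : Equiv.Perm (Fin n)) = 0 := by
  simp only [inv, inversions, Finset.card_eq_zero, Finset.filter_eq_empty_iff]
  rintro p - ⟨h1, h2⟩
  exact lt_asymm h1 h2

theorem strictMono_of_forall_adjacent {f : Fin n → Fin n} (h : ∀ i, f (lo i) < f (hi i)) :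
    StrictMono f := by
  have : ∀ (k : ℕ) (a b : Fin n), (a : ℕ) + k + 1 = b → f a < f b := by
    intro k
    induction k with
    | zero =>
      intro a b hab
      have hb : b = hi ⟨a, by omega⟩ := Fin.ext hab.symm
      exact hb ▸ h ⟨a, by omega⟩
    | succ k ih =>
      intro a b hab
      have hb : b = hi ⟨b - 1, by omega⟩ := Fin.ext (by simp; omega)
      refine (ih a (lo ⟨b - 1, by omega⟩) (by simp; omega)).trans ?_
      conv_rhs => rw [hb]
      exact h _
  intro a b hab
  exact this (b - a - 1) a b (by have := Fin.lt_def.mp hab; omega)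

theorem eq_one_of_forall_not_descent {w : Equiv.Perm (Fin n)} (h : ∀ i, ¬ Descent w i) : w = 1 := by
  have hm : StrictMono w := strictMono_of_forall_adjacent fun i => not_descent_iff.mp (h i)
  have := Subsingleton.elim (hm.orderIsoOfSurjective _ w.surjective) (OrderIso.refl _)
  ext a
  exact congrArg Fin.val (DFunLike.congr_fun this a)

theorem eq_revPerm_of_forall_descent {w : Equiv.Perm (Fin n)} (h : ∀ i, Descent w i) :
    w = Fin.revPerm := by
  have : Fin.revPerm * w = 1 := by
    refine eq_one_of_forall_not_descent fun i => ?_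
    rw [not_descent_iff]
    simpa [Descent] using h i
  rw [mul_eq_one_iff_inv_eq] at this
  rw [← this]
  ext a
  simp [Equiv.Perm.inv_def]

theorem exists_descent_of_ne_one {w : Equiv.Perm (Fin n)} (h : w ≠ 1) : ∃ i, Descent w i := by
  by_contra! hc
  exact h (eq_one_of_forall_not_descent hc)

theorem exists_not_descent_of_ne_revPerm {w : Equiv.Perm (Fin n)} (h : w ≠ Fin.revPerm) :
    ∃ i, ¬ Descent w i := by
  by_contra! hc
  exact h (eq_revPerm_of_forall_descent hc)

theorem not_descent_one (i : Fin (n - 1)) : ¬ Descent 1 i := by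
  rw [not_descent_iff]; exact lo_lt_hi i

theorem descent_revPerm (i : Fin (n - 1)) : Descent Fin.revPerm i := by
  simpa [Descent] using lo_lt_hi i

theorem inv_revPerm : inv (Fin.revPerm : Equiv.Perm (Fin n)) = ∑ i : Fin (n - 1), ((i : ℕ) + 1) := by
  have h1 : inversions (Fin.revPerm : Equiv.Perm (Fin n)) =
      (Finset.univ : Finset (Fin n × Fin n)).filter fun p => p.1 < p.2 := by
    simp [inversions]
  rw [inv, h1, Finset.card_filter, Fintype.sum_prod_type_right]
  have h2 : ∀ b : Fin n, (∑ a : Fin n, if a < b then 1 else 0) = (b : ℕ) := by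
    intro b
    rw [← Finset.card_filter]
    have : (Finset.univ.filter fun a => a < b) = Finset.Iio b := by ext; simp
    rw [this, Fin.card_Iio]
  simp only [h2]
  cases n with
  | zero => rfl
  | succ m => rw [Fin.sum_univ_succ]; simp

/-- The permutations sending the first `A.card` positions onto `A`. -/
def shuffles (A : Finset (Fin n)) : Finset (Equiv.Perm (Fin n)) :=
  Finset.univ.filter fun w => ∀ p : Fin n, w p ∈ A ↔ (p : ℕ) < A.card

theorem shuffles_nonempty (A : Finset (Fin n)) : (shuffles A).Nonempty := by
  have hA : A.card ≤ n := by simpa using A.card_le_univ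
  have e : {p : Fin n // (p : ℕ) < A.card} ≃ {p : Fin n // p ∈ A} := by
    refine Fintype.equivOfCardEq ?_
    rw [Fintype.card_subtype, Fintype.card_coe]
    rw [Fin.card_filter_val_lt]
    omega
  refine ⟨e.extendSubtype, ?_⟩
  simp only [shuffles, Finset.mem_filter, Finset.mem_univ, true_and]
  intro p
  by_cases hp : (p : ℕ) < A.card
  · exact iff_of_true (e.extendSubtype_mem p hp) hp
  · exact iff_of_false (e.extendSubtype_not_mem p hp) hp

theorem mul_adjSwap_mem_shuffles {A : Finset (Fin n)} {w : Equiv.Perm (Fin n)}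
    (hw : w ∈ shuffles A) {i : Fin (n - 1)} (hi : (i : ℕ) + 1 ≠ A.card) :
    w * adjSwap i ∈ shuffles A := by
  simp only [shuffles, Finset.mem_filter, Finset.mem_univ, true_and] at hw ⊢
  intro p
  rw [Equiv.Perm.mul_apply, hw, val_adjSwap]
  split_ifs <;> omega

/-- There is a permutation with at most one ascent, in position `A.card - 1`, such that every
`v ∈ A` with `v + 1 ∉ A` precedes `v + 1`. -/
theorem exists_descents_of_finset (A : Finset (Fin n)) : ∃ w : Equiv.Perm (Fin n),
    (∀ i : Fin (n - 1), (i : ℕ) + 1 ≠ A.card → Descent w i) ∧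
    ∀ i, lo i ∈ A → hi i ∉ A → ¬ Descent w⁻¹ i := by
  obtain ⟨w, hw, hmax⟩ := (shuffles A).exists_max_image inv (shuffles_nonempty A)
  refine ⟨w, fun i hi => ?_, fun i h1 h2 => ?_⟩
  · by_contra hd
    have := hmax _ (mul_adjSwap_mem_shuffles hw hi)
    rw [inv_mul_adjSwap_of_not_descent hd] at this
    omega
  · simp only [shuffles, Finset.mem_filter, Finset.mem_univ, true_and] at hw
    have h3 := hw (w⁻¹ (lo i))
    have h4 := hw (w⁻¹ (hi i))
    simp only [Equiv.Perm.coe_inv, Equiv.apply_symm_apply, h1, h2, true_iff, false_iff] at h3 h4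
    rw [not_descent_iff, Fin.lt_def, Equiv.Perm.coe_inv]
    omega

/-- There is a permutation with at most one left descent, namely `A.card - 1`, that has a descent
in every position `v ∉ A` with `v + 1 ∈ A`. -/
theorem exists_ascents_of_finset (A : Finset (Fin n)) : ∃ w : Equiv.Perm (Fin n),
    (∀ i : Fin (n - 1), (i : ℕ) + 1 ≠ A.card → ¬ Descent w⁻¹ i) ∧
    ∀ i, lo i ∉ A → hi i ∈ A → Descent w i := by
  obtain ⟨w, hw, hmin⟩ := (shuffles A).exists_min_image inv (shuffles_nonempty A)
  refine ⟨w⁻¹, fun i hi hd => ?_, fun i h1 h2 => ?_⟩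
  · have := hmin _ (mul_adjSwap_mem_shuffles hw hi)
    rw [_root_.inv_inv] at hd
    have := inv_mul_adjSwap_of_descent hd
    omega
  · simp only [shuffles, Finset.mem_filter, Finset.mem_univ, true_and] at hw
    have h3 := hw (w⁻¹ (lo i))
    have h4 := hw (w⁻¹ (hi i))
    simp only [Equiv.Perm.coe_inv, Equiv.apply_symm_apply, h1, h2, true_iff, false_iff] at h3 h4
    rw [Descent, Fin.lt_def, Equiv.Perm.coe_inv]
    omega

theorem exists_finset_card_mem_notMem {a b : Fin n} (hab : a ≠ b) (i : Fin (n - 1)) :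
    ∃ A : Finset (Fin n), A.card = i + 1 ∧ a ∈ A ∧ b ∉ A := by
  obtain ⟨A, h1, h2, h3⟩ := Finset.exists_subsuperset_card_eq
    (s := {a}) (t := Finset.univ.erase b) (n := i + 1) (by simpa using hab) (by simp) (by simp)
  exact ⟨A, h3, by simpa using h1, fun hb => by simpa using h2 hb⟩

end BraidPerm

namespace PresentedMonoid

variable {α : Type*} {rels : FreeMonoid α → FreeMonoid α → Prop}

theorem induction_mul_of {p : PresentedMonoid rels → Prop} (one : p 1)
    (mul_of : ∀ x i, p x → p (x * of rels i)) (x : PresentedMonoid rels) : p x := by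
  refine Submonoid.induction_of_closure_eq_top_right (closure_range_of rels) x one ?_
  rintro x _ ⟨i, rfl⟩ hx
  exact mul_of x i hx

theorem induction_of_mul {p : PresentedMonoid rels → Prop} (one : p 1)
    (of_mul : ∀ i x, p x → p (of rels i * x)) (x : PresentedMonoid rels) : p x := by
  refine Submonoid.induction_of_closure_eq_top_left (closure_range_of rels) x one ?_
  rintro _ ⟨i, rfl⟩ x hx
  exact of_mul i x hx

theorem eq_one_or_eq_mul_of (x : PresentedMonoid rels) : x = 1 ∨ ∃ y i, x = y * of rels i :=
  induction_mul_of (p := fun x => x = 1 ∨ ∃ y i, x = y * of rels i) (Or.inl rfl)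
    (fun y i _ => Or.inr ⟨y, i, rfl⟩) x

end PresentedMonoid

namespace PositiveBraid

open BraidPerm

variable {n : ℕ}

/-- The Artin generator with index `i`. -/
abbrev gen (i : Fin (n - 1)) : PositiveBraid n := PresentedMonoid.of (BraidRel n) i

theorem gen_comm (i j : Fin (n - 1)) (h : (i : ℕ) + 2 ≤ j) : gen i * gen j = gen j * gen i :=
  PresentedMonoid.mk_eq_mk_of_rel (BraidRel.comm i j h)

theorem gen_braid (i j : Fin (n - 1)) (h : (i : ℕ) + 1 = j) :
    gen i * gen j * gen i = gen j * gen i * gen j :=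
  PresentedMonoid.mk_eq_mk_of_rel (BraidRel.braid i j h)

/-- The word length, as a monoid homomorphism. -/
def lengthHom (n : ℕ) : PositiveBraid n →* Multiplicative ℕ :=
  PresentedMonoid.lift (fun _ => Multiplicative.ofAdd 1) (by rintro _ _ (_ | _) <;> simp)

/-- The word length of a positive braid. -/
def length (x : PositiveBraid n) : ℕ := (lengthHom n x).toAdd

@[simp] theorem length_one : length (1 : PositiveBraid n) = 0 := by simp [length]

@[simp] theorem length_mul (x y : PositiveBraid n) : length (x * y) = length x + length y := by
  simp [length]

@[simp] theorem length_gen (i : Fin (n - 1)) : length (gen i) = 1 := rfl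

/-- The permutation underlying a positive braid. -/
def perm (n : ℕ) : PositiveBraid n →* Equiv.Perm (Fin n) :=
  PresentedMonoid.lift adjSwap (by
    rintro _ _ (⟨i, j, h⟩ | ⟨i, j, h⟩)
    · simpa using adjSwap_comm i j h
    · simpa using adjSwap_braid i j h)

@[simp] theorem perm_gen (i : Fin (n - 1)) : perm n (gen i) = adjSwap i := rfl

theorem eq_one_of_length_eq_zero {x : PositiveBraid n} (h : length x = 0) : x = 1 := by
  obtain rfl | ⟨y, i, rfl⟩ := x.eq_one_or_eq_mul_of
  · rfl
  · simp at h

theorem inv_mul_perm_le (w : Equiv.Perm (Fin n)) (x : PositiveBraid n) :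
    inv (w * perm n x) ≤ inv w + length x := by
  induction x using PresentedMonoid.induction_mul_of with
  | one => simp
  | mul_of x i ih =>
    have := inv_mul_adjSwap_le (w * perm n x) i
    rw [map_mul, perm_gen, ← mul_assoc, length_mul, length_gen]
    omega

theorem inv_perm_le (x : PositiveBraid n) : inv (perm n x) ≤ length x := by
  simpa using inv_mul_perm_le 1 x

/-- A positive braid is reduced if its length is the number of inversions of its permutation. -/
def Reduced (x : PositiveBraid n) : Prop := length x = inv (perm n x)

theorem Reduced.of_mul_right {x y : PositiveBraid n} (h : Reduced (x * y)) : Reduced x := by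
  have h1 := inv_mul_perm_le (perm n x) y
  have h2 := inv_perm_le x
  rw [Reduced, map_mul, length_mul] at h
  rw [Reduced]
  omega

theorem Reduced.descent {x : PositiveBraid n} {i : Fin (n - 1)} (h : Reduced (x * gen i)) :
    Descent (perm n (x * gen i)) i := by
  have hx : Reduced x := h.of_mul_right
  rw [Reduced, map_mul, perm_gen, length_mul, length_gen] at h
  rw [Reduced] at hx
  rw [map_mul, perm_gen, descent_mul_adjSwap]
  intro hd
  have := inv_mul_adjSwap_of_descent hd
  omega

theorem Reduced.mul_gen {x : PositiveBraid n} (hx : Reduced x) {i : Fin (n - 1)}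
    (h : ¬ Descent (perm n x) i) : Reduced (x * gen i) := by
  rw [Reduced, map_mul, perm_gen, length_mul, length_gen, inv_mul_adjSwap_of_not_descent h, hx]

theorem exists_reduced (w : Equiv.Perm (Fin n)) : ∃ x, Reduced x ∧ perm n x = w := by
  induction h : inv w generalizing w with
  | zero =>
    refine ⟨1, by simp [Reduced], ?_⟩
    rw [map_one]
    by_contra hw
    obtain ⟨i, hi⟩ := exists_descent_of_ne_one (Ne.symm hw)
    have := inv_mul_adjSwap_of_descent hi
    omega
  | succ k ih =>
    have hw : w ≠ 1 := by rintro rfl; simp at h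
    obtain ⟨i, hi⟩ := exists_descent_of_ne_one hw
    have := inv_mul_adjSwap_of_descent hi
    obtain ⟨x, hx, hxw⟩ := ih (w * adjSwap i) (by omega)
    refine ⟨x * gen i, hx.mul_gen ?_, by
      rw [map_mul, hxw, perm_gen, mul_assoc, adjSwap_mul_self, mul_one]⟩
    rwa [hxw, descent_mul_adjSwap, not_not]

theorem descent_mul_adjSwap_of_far {w : Equiv.Perm (Fin n)} {i j : Fin (n - 1)}
    (h : (i : ℕ) + 2 ≤ j ∨ (j : ℕ) + 2 ≤ i) : Descent (w * adjSwap i) j ↔ Descent w j := by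
  have h1 : adjSwap i (lo j) = lo j := by
    ext; rw [val_adjSwap, val_lo]; split_ifs <;> omega
  have h2 : adjSwap i (hi j) = hi j := by
    ext; rw [val_adjSwap, val_hi]; split_ifs <;> omega
  simp [Descent, h1, h2]

/-- Two reduced positive braids with the same permutation are equal. -/
theorem Reduced.ext {x y : PositiveBraid n} (hx : Reduced x) (hy : Reduced y)
    (hxy : perm n x = perm n y) : x = y := by
  induction hk : length x using Nat.strong_induction_on generalizing x y with
  | _ k ih =>
  have hlen : length y = k := by rw [hy, ← hxy, ← hx, hk]
  obtain rfl | ⟨x', i, rfl⟩ := x.eq_one_or_eq_mul_of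
  · exact (eq_one_of_length_eq_zero (by rw [hlen, ← hk, length_one])).symm
  obtain rfl | ⟨y', j, rfl⟩ := y.eq_one_or_eq_mul_of
  · exact eq_one_of_length_eq_zero (by rw [hk, ← hlen, length_one])
  have hx' := hx.of_mul_right
  have hy' := hy.of_mul_right
  wlog hij : i ≤ j generalizing i j x' y'
  · exact (this y' j hy hlen x' i hx hk hxy.symm hy' hx' (le_of_not_ge hij)).symm
  have hdi : Descent (perm n (x' * gen i)) i := hx.descent
  have hdj : Descent (perm n (x' * gen i)) j := hxy ▸ hy.descent
  have hpx : perm n x' = perm n (x' * gen i) * adjSwap i := by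
    rw [map_mul, perm_gen, mul_assoc, adjSwap_mul_self, mul_one]
  have hpy : perm n y' = perm n (x' * gen i) * adjSwap j := by
    rw [hxy, map_mul, perm_gen, mul_assoc, adjSwap_mul_self, mul_one]
  generalize perm n (x' * gen i) = w at hdi hdj hpx hpy
  rw [length_mul, length_gen] at hk hlen
  have ihx : ∀ z, Reduced z → perm n z = w * adjSwap i → x' = z := fun z hz hzw =>
    ih (length x') (by omega) hx' hz (hpx.trans hzw.symm) rfl
  have ihy : ∀ z, Reduced z → perm n z = w * adjSwap j → y' = z := fun z hz hzw =>
    ih (length y') (by omega) hy' hz (hpy.trans hzw.symm) rfl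
  obtain h | h | h : (i : ℕ) = j ∨ (i : ℕ) + 1 = j ∨ (i : ℕ) + 2 ≤ j := by
    have := Fin.le_def.mp hij; omega
  · obtain rfl := Fin.ext h
    rw [ihx y' hy' hpy]
  · have hij : lo j = hi i := Fin.ext h.symm
    have hji1 : adjSwap j (lo i) = lo i := by
      ext; rw [val_adjSwap, val_lo]; split_ifs <;> omega
    have hij1 : adjSwap i (hi j) = hi j := by
      ext; rw [val_adjSwap, val_hi]; split_ifs <;> omega
    have hjh : adjSwap j (hi i) = hi j := by rw [← hij, adjSwap_lo]
    have hil : adjSwap i (lo j) = lo i := by rw [hij, adjSwap_hi]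
    obtain ⟨z, hz, hzw⟩ := exists_reduced (w * adjSwap i * adjSwap j * adjSwap i)
    have hzw' : perm n z = w * adjSwap j * adjSwap i * adjSwap j := by
      rw [hzw, mul_assoc, mul_assoc, ← mul_assoc (adjSwap i), adjSwap_braid i j h]
      simp only [mul_assoc]
    have hdi' : w (hi i) < w (lo i) := hdi
    have hdj' : w (hi j) < w (hi i) := hij ▸ hdj
    have e1 : perm n (z * gen i) = w * adjSwap i * adjSwap j := by
      rw [map_mul, hzw, perm_gen, mul_assoc, adjSwap_mul_self, mul_one]
    have e2 : perm n (z * gen j) = w * adjSwap j * adjSwap i := by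
      rw [map_mul, hzw', perm_gen, mul_assoc, adjSwap_mul_self, mul_one]
    have r1 : Reduced (z * gen i) := hz.mul_gen (by
      rw [not_descent_iff, hzw]
      simpa [hji1, hij1, hjh, hil] using hdj')
    have r2 : Reduced (z * gen j) := hz.mul_gen (by
      rw [not_descent_iff, hzw', hij]
      simpa [hji1, hij1, hjh, hil, hij] using hdi')
    have r3 : Reduced (z * gen i * gen j) := r1.mul_gen (by
      rw [not_descent_iff, e1, hij]
      simpa [hji1, hij1, hjh, hil] using hdj'.trans hdi')
    have r4 : Reduced (z * gen j * gen i) := r2.mul_gen (by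
      rw [not_descent_iff, e2]
      simpa [hji1, hij1, hjh, hil] using hdj'.trans hdi')
    rw [ihx _ r3 (by rw [map_mul, e1, perm_gen, mul_assoc, adjSwap_mul_self, mul_one]),
      ihy _ r4 (by rw [map_mul, e2, perm_gen, mul_assoc, adjSwap_mul_self, mul_one])]
    simpa only [mul_assoc] using congrArg (z * ·) (gen_braid i j h)
  · obtain ⟨z, hz, hzw⟩ := exists_reduced (w * adjSwap i * adjSwap j)
    have hzw' : perm n z = w * adjSwap j * adjSwap i := by
      rw [hzw, mul_assoc, adjSwap_comm i j h, mul_assoc]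
    have r1 : Reduced (z * gen j) := hz.mul_gen (by
      rw [hzw, descent_mul_adjSwap, not_not, descent_mul_adjSwap_of_far (Or.inl h)]
      exact hdj)
    have r2 : Reduced (z * gen i) := hz.mul_gen (by
      rw [hzw', descent_mul_adjSwap, not_not, descent_mul_adjSwap_of_far (Or.inr h)]
      exact hdi)
    rw [ihx _ r1 (by rw [map_mul, hzw, perm_gen, mul_assoc, adjSwap_mul_self, mul_one]),
      ihy _ r2 (by rw [map_mul, hzw', perm_gen, mul_assoc, adjSwap_mul_self, mul_one]),
      mul_assoc, mul_assoc, gen_comm i j h]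

end PositiveBraid

namespace BraidPerm

variable {n : ℕ}

theorem finRange_filter_le (k : Fin n) :
    (List.finRange n).filter (· ≤ k) = (List.finRange (k + 1)).map (Fin.castLE (by omega)) := by
  refine List.Perm.eq_of_pairwise (le := (· < ·)) (fun a b _ _ h1 h2 => (lt_asymm h1 h2).elim)
    ((List.pairwise_lt_finRange n).filter _) ?_ ?_
  · rw [List.pairwise_map]
    exact (List.pairwise_lt_finRange _).imp fun h => h
  · rw [List.perm_ext_iff_of_nodup ((List.nodup_finRange n).filter _)
      ((List.nodup_finRange _).map (Fin.castLE_injective _))]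
    intro a
    simp only [List.mem_filter, List.mem_finRange, true_and, decide_eq_true_eq, List.mem_map]
    constructor
    · intro h
      exact ⟨⟨a, by have := Fin.le_def.mp h; omega⟩, rfl⟩
    · rintro ⟨b, rfl⟩
      rw [Fin.le_def]
      simp only [Fin.val_castLE]
      omega

theorem prod_adjSwap_apply (m : ℕ) (hm : m ≤ n - 1) (a : Fin n) :
    ((((List.finRange m).map fun i => adjSwap (Fin.castLE hm i)).prod a : Fin n) : ℕ) =
      if (a : ℕ) < m then (a : ℕ) + 1 else if (a : ℕ) = m then 0 else a := by
  induction m generalizing a with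
  | zero => simp
  | succ m ih =>
    have := ih (by omega) (adjSwap (Fin.castLE hm (Fin.last m)) a)
    rw [List.finRange_succ_last, List.map_append, List.prod_append, List.map_map]
    simp only [List.map_cons, List.map_nil, List.prod_singleton, Equiv.Perm.mul_apply]
    refine this.trans ?_
    rw [val_adjSwap]
    simp only [Fin.val_castLE, Fin.val_last]
    split_ifs <;> omega

end BraidPerm

namespace PositiveBraid

open BraidPerm

variable {n : ℕ}

/-- The factor `σ_1 ⋯ σ_{k+1}` of `Δ`. -/
def row (k : Fin (n - 1)) : PositiveBraid n :=
  (((List.finRange (n - 1)).filter (· ≤ k)).map gen).prod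

theorem row_eq (k : Fin (n - 1)) : row k =
    ((List.finRange (k + 1)).map fun i => gen (Fin.castLE (by omega) i)).prod := by
  rw [row, finRange_filter_le, List.map_map]; rfl

theorem perm_row_apply (k : Fin (n - 1)) (a : Fin n) : (perm n (row k) a : ℕ) =
    if (a : ℕ) < k + 1 then (a : ℕ) + 1 else if (a : ℕ) = k + 1 then 0 else a := by
  rw [row_eq, map_list_prod, List.map_map]
  exact prod_adjSwap_apply _ _ a

theorem perm_prod_row_apply (m : ℕ) (hm : m ≤ n - 1) (a : Fin n) :
    (perm n ((List.finRange m).reverse.map fun k => row (Fin.castLE hm k)).prod a : ℕ) =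
      if (a : ℕ) ≤ m then m - a else a := by
  induction m generalizing a with
  | zero => simp
  | succ m ih =>
    have := ih (by omega) a
    rw [List.finRange_succ_last, List.reverse_append, List.map_append, List.prod_append, map_mul,
      ← List.map_reverse, List.map_map]
    simp only [List.reverse_singleton, List.map_cons, List.map_nil, List.prod_singleton,
      Equiv.Perm.mul_apply]
    rw [perm_row_apply]
    erw [this]
    simp only [Fin.val_castLE, Fin.val_last]
    split_ifs <;> omega

theorem perm_Delta : perm n (Delta n) = Fin.revPerm := by
  ext a
  have := perm_prod_row_apply (n - 1) le_rfl a
  simp only [Fin.revPerm_apply, Fin.val_rev]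
  refine Eq.trans ?_ (this.trans ?_)
  · rfl
  · split_ifs <;> omega

theorem length_list_prod (l : List (PositiveBraid n)) : length l.prod = (l.map length).sum := by
  induction l with
  | nil => simp
  | cons a l ih => simp [ih]

theorem length_row (k : Fin (n - 1)) : length (row k) = k + 1 := by
  rw [row_eq, length_list_prod, List.map_map]
  simp [Function.comp_def]

theorem length_Delta : length (Delta n) = ∑ i : Fin (n - 1), ((i : ℕ) + 1) := by
  have : Delta n = ((List.finRange (n - 1)).reverse.map row).prod := rfl
  rw [this, length_list_prod, List.map_map, List.map_reverse, List.sum_reverse, ← List.ofFn_eq_map,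
    List.sum_ofFn]
  simp [length_row]

theorem reduced_Delta : Reduced (Delta n) := by
  rw [Reduced, length_Delta, perm_Delta, inv_revPerm]

theorem Reduced.leftDvd_Delta {x : PositiveBraid n} (hx : Reduced x) :
    Garside.LeftDvd x (Delta n) := by
  have hb : ∀ w : Equiv.Perm (Fin n), inv w ≤ Fintype.card (Fin n × Fin n) :=
    fun w => Finset.card_le_univ _
  induction hk : Fintype.card (Fin n × Fin n) - inv (perm n x) generalizing x with
  | zero =>
    refine ⟨1, ?_⟩
    rw [mul_one]
    refine reduced_Delta.ext hx (perm_Delta.trans (eq_revPerm_of_forall_descent fun i => ?_).symm)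
    by_contra hd
    have := hb (perm n x * adjSwap i)
    rw [inv_mul_adjSwap_of_not_descent hd] at this
    omega
  | succ k ih =>
    by_cases hall : ∀ i, Descent (perm n x) i
    · refine ⟨1, ?_⟩
      rw [mul_one]
      exact reduced_Delta.ext hx (perm_Delta.trans (eq_revPerm_of_forall_descent hall).symm)
    · push Not at hall
      obtain ⟨i, hi⟩ := hall
      obtain ⟨z, hz⟩ := ih (hx.mul_gen hi) (by
        rw [map_mul, perm_gen, inv_mul_adjSwap_of_not_descent hi]; omega)
      exact ⟨gen i * z, by rw [hz, mul_assoc]⟩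

theorem mem_simples_iff {x : PositiveBraid n} : x ∈ Garside.simples (Delta n) ↔ Reduced x :=
  ⟨fun ⟨_, hz⟩ => (hz ▸ reduced_Delta : Reduced (x * _)).of_mul_right, Reduced.leftDvd_Delta⟩

theorem Reduced.descent_inv {x : PositiveBraid n} {i : Fin (n - 1)} (h : Reduced (gen i * x)) :
    Descent (perm n (gen i * x))⁻¹ i := by
  rw [map_mul, perm_gen, mul_inv_rev, adjSwap_inv, descent_mul_adjSwap]
  intro hd
  have h1 := inv_mul_adjSwap_of_descent hd
  have h2 := inv_perm_le x
  rw [Reduced, map_mul, perm_gen, length_mul, length_gen, ← BraidPerm.inv_inv, mul_inv_rev,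
    adjSwap_inv] at h
  rw [BraidPerm.inv_inv] at h1
  omega

/-- The vertices of the Charney graph of `B_n^+`. -/
abbrev Vertex (n : ℕ) : Type :=
  {x : PositiveBraid n // x ∈ Garside.simples (Delta n) \ {1, Delta n}}

theorem Vertex.reduced (x : Vertex n) : Reduced x.1 := mem_simples_iff.mp x.2.1

theorem Vertex.perm_ne_one (x : Vertex n) : perm n x.1 ≠ 1 := fun h =>
  x.2.2 (Or.inl (x.reduced.ext (by simp [Reduced]) (by rw [h, map_one])))

theorem Vertex.perm_ne_revPerm (x : Vertex n) : perm n x.1 ≠ Fin.revPerm := fun h =>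
  x.2.2 (Or.inr (x.reduced.ext reduced_Delta (by rw [h, perm_Delta])))

theorem exists_vertex {w : Equiv.Perm (Fin n)} (h1 : w ≠ 1) (h2 : w ≠ Fin.revPerm) :
    ∃ x : Vertex n, perm n x.1 = w := by
  obtain ⟨x, hx, rfl⟩ := exists_reduced w
  refine ⟨⟨x, mem_simples_iff.mpr hx, ?_⟩, rfl⟩
  rintro (rfl | rfl)
  · simp at h1
  · exact h2 perm_Delta

theorem adj_of_descents {x y : Vertex n}
    (h : ∀ i, Descent (perm n y.1)⁻¹ i → Descent (perm n x.1) i) :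
    (charneyGraph n).Adj x y := by
  rintro _ ⟨⟨i, rfl⟩, z, hz⟩
  refine ⟨⟨i, rfl⟩, fun hs => ?_⟩
  have hy : Descent (perm n y.1)⁻¹ i := by
    have := y.reduced
    rw [hz] at this ⊢
    exact this.descent_inv
  have := (mem_simples_iff.mp hs).descent
  rw [map_mul, perm_gen, descent_mul_adjSwap] at this
  exact this (h i hy)

theorem hasLoop (hn : 3 ≤ n) : (charneyGraph n).HasLoop := by
  let i : Fin (n - 1) := ⟨0, by omega⟩
  let j : Fin (n - 1) := ⟨1, by omega⟩
  have hi : Descent (adjSwap i) i := by simpa [Descent] using lo_lt_hi i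
  have hj : ¬ Descent (adjSwap i) j := by
    rw [not_descent_iff, Fin.lt_def, val_adjSwap, val_adjSwap]
    simp [i, j]
  obtain ⟨x, hx⟩ := exists_vertex (w := adjSwap i)
    (fun h => not_descent_one i (h ▸ hi)) (fun h => hj (h ▸ descent_revPerm j))
  exact ⟨x, adj_of_descents fun k hk => by rwa [hx, adjSwap_inv] at *⟩

theorem stronglyConnected (hn : 3 ≤ n) : (charneyGraph n).StronglyConnected := by
  intro x y
  have other : ∀ k : ℕ, ∃ i : Fin (n - 1), (i : ℕ) + 1 ≠ k := fun k => by
    by_cases hk : k = 1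
    · exact ⟨⟨1, by omega⟩, by simp; omega⟩
    · exact ⟨⟨0, by omega⟩, by simp; omega⟩
  have hrev : (Fin.revPerm : Equiv.Perm (Fin n))⁻¹ = Fin.revPerm := rfl
  obtain ⟨i, hi⟩ := exists_descent_of_ne_one (Vertex.perm_ne_one x)
  obtain ⟨j, hj⟩ : ∃ j, ¬ Descent (perm n y.1)⁻¹ j :=
    exists_not_descent_of_ne_revPerm fun h => Vertex.perm_ne_revPerm y (by
      rw [← _root_.inv_inv (perm n y.1), h, hrev])
  let O : Finset (Fin n) := Finset.univ.filter fun a => (a : ℕ) % 2 = 1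
  have hO1 : 0 < O.card := Finset.card_pos.mpr ⟨⟨1, by omega⟩, by simp [O]⟩
  have hO2 : O.card < n := by
    have : O ⊂ Finset.univ := by
      refine Finset.ssubset_univ_iff.mpr fun h => ?_
      have : (⟨0, by omega⟩ : Fin n) ∈ O := h ▸ Finset.mem_univ _
      simp [O] at this
    simpa using Finset.card_lt_card this
  let c : Fin (n - 1) := ⟨O.card - 1, by omega⟩
  have hc : (c : ℕ) + 1 = O.card := by simp only [c]; omega
  obtain ⟨A, hA, hA1, hA2⟩ := exists_finset_card_mem_notMem (lo_lt_hi c).ne' i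
  obtain ⟨B, hB, hB1, hB2⟩ := exists_finset_card_mem_notMem (lo_lt_hi c).ne j
  obtain ⟨w₁, hw₁, hw₁'⟩ := exists_ascents_of_finset A
  obtain ⟨w₂, hw₂, hw₂'⟩ := exists_ascents_of_finset O
  obtain ⟨w₃, hw₃, hw₃'⟩ := exists_descents_of_finset O
  obtain ⟨w₄, hw₄, hw₄'⟩ := exists_descents_of_finset B
  have asc : ∀ {C : Finset (Fin n)} {w : Equiv.Perm (Fin n)},
      (∀ i : Fin (n - 1), (i : ℕ) + 1 ≠ C.card → ¬ Descent w⁻¹ i) → w ≠ Fin.revPerm := by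
    rintro C _ h rfl
    obtain ⟨k, hk⟩ := other C.card
    exact h k hk (hrev ▸ descent_revPerm k)
  have desc : ∀ {C : Finset (Fin n)} {w : Equiv.Perm (Fin n)},
      (∀ i : Fin (n - 1), (i : ℕ) + 1 ≠ C.card → Descent w i) → w ≠ 1 := by
    rintro C _ h rfl
    obtain ⟨k, hk⟩ := other C.card
    exact not_descent_one k (h k hk)
  have hlo : ∀ k, lo k ∈ O ↔ (k : ℕ) % 2 = 1 := fun k => by simp [O]
  have hhi : ∀ k, BraidPerm.hi k ∈ O ↔ (k : ℕ) % 2 = 0 := fun k => by simp [O]; omega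
  have d₁ : Descent w₁ c := hw₁' c hA2 hA1
  have d₂ : ∀ k : Fin (n - 1), (k : ℕ) % 2 = 0 → Descent w₂ k := fun k hk =>
    hw₂' k (by rw [hlo]; omega) (by rw [hhi]; omega)
  have d₃ : ∀ k : Fin (n - 1), (k : ℕ) % 2 = 1 → ¬ Descent w₃⁻¹ k := fun k hk =>
    hw₃' k (by rw [hlo]; omega) (by rw [hhi]; omega)
  have d₄ : ¬ Descent w₄⁻¹ c := hw₄' c hB1 hB2
  obtain ⟨v₁, rfl⟩ := exists_vertex (fun h => not_descent_one c (h ▸ d₁)) (asc hw₁)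
  obtain ⟨v₂, rfl⟩ := exists_vertex
    (fun h => not_descent_one ⟨0, by omega⟩ (h ▸ d₂ ⟨0, by omega⟩ rfl)) (asc hw₂)
  obtain ⟨v₃, rfl⟩ := exists_vertex (desc hw₃) (fun h =>
    d₃ ⟨1, by omega⟩ rfl (by rw [h, hrev]; exact descent_revPerm _))
  obtain ⟨v₄, rfl⟩ := exists_vertex (desc hw₄) (fun h =>
    d₄ (by rw [h, hrev]; exact descent_revPerm _))
  have e₀ : (charneyGraph n).Adj x v₁ := adj_of_descents fun k hk => by
    have : k = i := by
      by_contra hne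
      exact hw₁ k (fun h => hne (Fin.ext (by omega))) hk
    rwa [this]
  have e₁ : (charneyGraph n).Adj v₁ v₂ := adj_of_descents fun k hk => by
    have : k = c := by
      by_contra hne
      exact hw₂ k (fun h => hne (Fin.ext (by omega))) hk
    rwa [this]
  have e₂ : (charneyGraph n).Adj v₂ v₃ := adj_of_descents fun k hk => by
    refine d₂ k ?_
    have : ¬ (k : ℕ) % 2 = 1 := fun h => d₃ k h hk
    omega
  have e₃ : (charneyGraph n).Adj v₃ v₄ := adj_of_descents fun k hk =>
    hw₃ k fun h => d₄ (by rwa [show k = c from Fin.ext (by omega)] at hk)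
  have e₄ : (charneyGraph n).Adj v₄ y := adj_of_descents fun k hk =>
    hw₄ k fun h => hj (by rwa [show k = j from Fin.ext (by omega)] at hk)
  exact ((((Relation.ReflTransGen.single e₀).tail e₁).tail e₂).tail e₃).tail e₄

end PositiveBraid

namespace DualBraid

open BraidPerm

variable {n : ℕ}

/-- The Birman-Ko-Lee generator with index `p`. -/
abbrev gen (p : DualIndex n) : DualBraid n := PresentedMonoid.of (DualBraidRel n) p

/-- The word length, as a monoid homomorphism. -/
def lengthHom (n : ℕ) : DualBraid n →* Multiplicative ℕ :=
  PresentedMonoid.lift (fun _ => Multiplicative.ofAdd 1) (by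
    rintro _ _ (_ | _ | _ | _) <;> simp [DualIndex.letter])

/-- The word length of a dual braid. -/
def length (x : DualBraid n) : ℕ := (lengthHom n x).toAdd

@[simp] theorem length_one : length (1 : DualBraid n) = 0 := by simp [length]

@[simp] theorem length_mul (x y : DualBraid n) : length (x * y) = length x + length y := by
  simp [length]

@[simp] theorem length_gen (p : DualIndex n) : length (gen p) = 1 := rfl

theorem eq_one_of_length_eq_zero {x : DualBraid n} (h : length x = 0) : x = 1 := by
  obtain rfl | ⟨y, i, rfl⟩ := x.eq_one_or_eq_mul_of
  · rfl
  · simp at h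

theorem swap_mul_swap_of_disjoint {a b c d : Fin n} (hac : a ≠ c) (had : a ≠ d) (hbc : b ≠ c)
    (hbd : b ≠ d) : Equiv.swap a b * Equiv.swap c d = Equiv.swap c d * Equiv.swap a b := by
  rw [Equiv.mul_swap_eq_swap_mul, Equiv.swap_apply_of_ne_of_ne hac.symm hbc.symm,
    Equiv.swap_apply_of_ne_of_ne had.symm hbd.symm]

/-- The permutation underlying a dual braid. -/
def perm (n : ℕ) : DualBraid n →* Equiv.Perm (Fin n) :=
  PresentedMonoid.lift (fun p => Equiv.swap p.1.1 p.1.2) (by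
    rintro _ _ (⟨i, j, k, hij, hjk⟩ | ⟨i, j, k, hij, hjk⟩ | ⟨i, j, k, l, hij, hjk, hkl⟩ |
      ⟨i, k, l, j, hik, hkl, hlj⟩)
    · simp only [DualIndex.letter, map_mul, FreeMonoid.lift_eval_of]
      rw [Equiv.mul_swap_eq_swap_mul (Equiv.swap j k), Equiv.swap_apply_right,
        Equiv.swap_apply_of_ne_of_ne hij.ne (hij.trans hjk).ne]
    · simp only [DualIndex.letter, map_mul, FreeMonoid.lift_eval_of]
      rw [Equiv.mul_swap_eq_swap_mul (Equiv.swap i k), Equiv.swap_apply_left,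
        Equiv.swap_apply_of_ne_of_ne hij.ne' hjk.ne, Equiv.swap_comm k j]
    · simp only [DualIndex.letter, map_mul, FreeMonoid.lift_eval_of]
      exact swap_mul_swap_of_disjoint (hij.trans hjk).ne (hij.trans (hjk.trans hkl)).ne hjk.ne
        (hjk.trans hkl).ne
    · simp only [DualIndex.letter, map_mul, FreeMonoid.lift_eval_of]
      exact swap_mul_swap_of_disjoint hik.ne (hik.trans hkl).ne (hkl.trans hlj).ne' hlj.ne')

@[simp] theorem perm_gen (p : DualIndex n) : perm n (gen p) = Equiv.swap p.1.1 p.1.2 := rfl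

theorem perm_delta_apply (a : Fin n) :
    (perm n (delta n) a : ℕ) = if (a : ℕ) < n - 1 then (a : ℕ) + 1 else 0 := by
  rw [delta, map_list_prod, List.map_map]
  refine (prod_adjSwap_apply (n - 1) le_rfl a).trans ?_
  split_ifs <;> omega

/-! ### Factorizations of `δ` -/

/-- The generator `σ_{i,j}` with natural number indices, and `1` outside the index range. -/
def sigma (n i j : ℕ) : DualBraid n :=
  if h : i < j ∧ j < n then gen ⟨(⟨i, h.1.trans h.2⟩, ⟨j, h.2⟩), h.1⟩ else 1

theorem sigma_eq {i j : ℕ} (hij : i < j) (hj : j < n) :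
    sigma n i j = gen ⟨(⟨i, hij.trans hj⟩, ⟨j, hj⟩), hij⟩ := dif_pos ⟨hij, hj⟩

theorem gen_eq_sigma (p : DualIndex n) : gen p = sigma n p.1.1 p.1.2 :=
  (sigma_eq p.2 p.1.2.isLt).symm

theorem sigma_triangle₁ {i j k : ℕ} (hij : i < j) (hjk : j < k) (hk : k < n) :
    sigma n i j * sigma n j k = sigma n j k * sigma n i k := by
  rw [sigma_eq hij (hjk.trans hk), sigma_eq hjk hk, sigma_eq (hij.trans hjk) hk]
  exact PresentedMonoid.mk_eq_mk_of_rel (DualBraidRel.triangle₁ _ _ _ hij hjk)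

theorem sigma_triangle₂ {i j k : ℕ} (hij : i < j) (hjk : j < k) (hk : k < n) :
    sigma n i j * sigma n j k = sigma n i k * sigma n i j := by
  rw [sigma_triangle₁ hij hjk hk, sigma_eq hij (hjk.trans hk), sigma_eq hjk hk,
    sigma_eq (hij.trans hjk) hk]
  exact PresentedMonoid.mk_eq_mk_of_rel (DualBraidRel.triangle₂ _ _ _ hij hjk)

theorem sigma_disjoint {i j k l : ℕ} (hij : i < j) (hjk : j < k) (hkl : k < l) (hl : l < n) :
    sigma n i j * sigma n k l = sigma n k l * sigma n i j := by
  rw [sigma_eq hij (hjk.trans (hkl.trans hl)), sigma_eq hkl hl]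
  exact PresentedMonoid.mk_eq_mk_of_rel (DualBraidRel.disjoint _ _ _ _ hij hjk hkl)

/-- The element `σ_{p,p+1} σ_{p+1,p+2} ⋯ σ_{p+m-1,p+m}`. -/
def chain (n p : ℕ) : ℕ → DualBraid n
  | 0 => 1
  | m + 1 => chain n p m * sigma n (p + m) (p + m + 1)

theorem delta_eq_chain : delta n = chain n 0 (n - 1) := by
  have : ∀ (m : ℕ) (hm : m ≤ n - 1), ((List.finRange m).map fun i =>
      gen (DualIndex.consecutive (Fin.castLE hm i))).prod = chain n 0 m := by
    intro m
    induction m with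
    | zero => intro; rfl
    | succ m ih =>
      intro hm
      rw [List.finRange_succ_last, List.map_append, List.prod_append, List.map_map, chain,
        ← ih (by omega), sigma_eq (by omega) (by omega)]
      simp only [List.map_cons, List.map_nil, List.prod_singleton, zero_add]
      rfl
  exact this (n - 1) le_rfl

theorem chain_add (p a b : ℕ) : chain n p (a + b) = chain n p a * chain n (p + a) b := by
  induction b with
  | zero => simp [chain]
  | succ b ih => rw [← add_assoc, chain, ih, chain, mul_assoc, add_assoc p a b]

theorem chain_succ (p m : ℕ) : chain n p (m + 1) = sigma n p (p + 1) * chain n (p + 1) m := by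
  rw [add_comm, chain_add]; simp [chain]

theorem chain_succ_eq_mul_sigma {p m : ℕ} (h : p + m + 1 < n) :
    chain n p (m + 1) = chain n (p + 1) m * sigma n p (p + m + 1) := by
  induction m with
  | zero => simp [chain]
  | succ m ih =>
    rw [chain, ih (by omega), chain, mul_assoc, mul_assoc,
      show p + 1 + m = p + m + 1 by omega, show p + (m + 1) = p + m + 1 by omega,
      sigma_triangle₁ (by omega) (by omega) (by omega)]

theorem chain_succ_eq_sigma_mul {p m : ℕ} (h : p + m + 1 < n) :
    chain n p (m + 1) = sigma n p (p + m + 1) * chain n p m := by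
  induction m generalizing p with
  | zero => simp [chain]
  | succ m ih =>
    rw [chain_succ, ih (by omega), ← mul_assoc, sigma_triangle₂ (by omega) (by omega) (by omega),
      mul_assoc, ← chain_succ, show p + 1 + m + 1 = p + (m + 1) + 1 by omega]

theorem chain_mul_sigma_comm {p m a b : ℕ} (ha : p + m < a) (hab : a < b) (hb : b < n) :
    chain n p m * sigma n a b = sigma n a b * chain n p m := by
  induction m with
  | zero => simp [chain]
  | succ m ih =>
    rw [chain, mul_assoc, sigma_disjoint (by omega) (by omega) hab hb, ← mul_assoc,
      ih (by omega), mul_assoc]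

theorem sigma_mul_chain_comm {p m a b : ℕ} (hab : a < b) (hp : b < p) (hb : p + m < n) :
    sigma n a b * chain n p m = chain n p m * sigma n a b := by
  induction m with
  | zero => simp [chain]
  | succ m ih =>
    rw [chain, ← mul_assoc, ih (by omega), mul_assoc,
      sigma_disjoint hab (by omega) (by omega) (by omega), mul_assoc]

theorem leftDvd_delta_gen (p : DualIndex n) : ∃ z, delta n = gen p * z := by
  obtain ⟨⟨⟨i, hi⟩, ⟨j, hj⟩⟩, hij⟩ := p
  rw [gen_eq_sigma, delta_eq_chain]
  simp only [Fin.mk_lt_mk] at hij ⊢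
  have h1 : ∃ y, chain n 0 i * sigma n i j = sigma n i j * y := by
    cases i with
    | zero => exact ⟨1, by simp [chain]⟩
    | succ i =>
      refine ⟨chain n 0 i * sigma n i j, ?_⟩
      rw [chain, zero_add, mul_assoc, sigma_triangle₁ (by omega) hij hj, ← mul_assoc,
        chain_mul_sigma_comm (by omega) hij hj, mul_assoc]
  obtain ⟨y, hy⟩ := h1
  refine ⟨y * chain n i (j - i - 1) * chain n j (n - 1 - j), ?_⟩
  have h2 : chain n i (j - i) = sigma n i j * chain n i (j - i - 1) := by
    have := chain_succ_eq_sigma_mul (n := n) (p := i) (m := j - i - 1) (by omega)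
    rwa [show j - i - 1 + 1 = j - i by omega, show i + (j - i - 1) + 1 = j by omega] at this
  have h3 := chain_add (n := n) 0 i (j - i + (n - 1 - j))
  rw [zero_add, chain_add i, h2, show i + (j - i) = j by omega, ← mul_assoc, ← mul_assoc, hy,
    show i + (j - i + (n - 1 - j)) = n - 1 by omega] at h3
  rw [h3]
  simp only [mul_assoc]

theorem rightDvd_delta_gen (p : DualIndex n) : ∃ z, delta n = z * gen p := by
  obtain ⟨⟨⟨i, hi⟩, ⟨j, hj⟩⟩, hij⟩ := p
  rw [gen_eq_sigma, delta_eq_chain]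
  simp only [Fin.mk_lt_mk] at hij ⊢
  have h1 : ∃ y, sigma n i j * chain n j (n - 1 - j) = y * sigma n i j := by
    rcases hm : n - 1 - j with _ | m
    · exact ⟨1, by simp [chain]⟩
    · refine ⟨sigma n i (j + 1) * chain n (j + 1) m, ?_⟩
      rw [chain_succ, ← mul_assoc, sigma_triangle₂ hij (by omega) (by omega), mul_assoc,
        sigma_mul_chain_comm hij (by omega) (by omega), mul_assoc]
  obtain ⟨y, hy⟩ := h1
  refine ⟨chain n 0 i * chain n (i + 1) (j - i - 1) * y, ?_⟩
  have h2 : chain n i (j - i) = chain n (i + 1) (j - i - 1) * sigma n i j := by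
    have := chain_succ_eq_mul_sigma (n := n) (p := i) (m := j - i - 1) (by omega)
    rwa [show j - i - 1 + 1 = j - i by omega, show i + (j - i - 1) + 1 = j by omega] at this
  have h3 := chain_add (n := n) 0 i (j - i + (n - 1 - j))
  rw [zero_add, chain_add i, h2, show i + (j - i) = j by omega, mul_assoc (chain n (i + 1) _), hy,
    show i + (j - i + (n - 1 - j)) = n - 1 by omega] at h3
  rw [h3]
  simp only [mul_assoc]

theorem length_sigma {i j : ℕ} (hij : i < j) (hj : j < n) : length (sigma n i j) = 1 := by
  rw [sigma_eq hij hj]; rfl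

theorem length_chain {p m : ℕ} (h : p + m < n) : length (chain n p m) = m := by
  induction m with
  | zero => rfl
  | succ m ih => rw [chain, length_mul, ih (by omega), length_sigma (by omega) (by omega)]

theorem length_delta (hn : 0 < n) : length (delta n) = n - 1 := by
  rw [delta_eq_chain, length_chain (by omega)]

theorem val_perm_sigma {i j : ℕ} (hij : i < j) (hj : j < n) (a : Fin n) :
    (perm n (sigma n i j) a : ℕ) = if (a : ℕ) = i then j else if (a : ℕ) = j then i else a := by
  rw [sigma_eq hij hj, perm_gen, Equiv.swap_apply_def]
  simp only [Fin.ext_iff]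
  split_ifs <;> rfl

/-- Each interval chain has a left factor reversing the interval: the product of the generators
that join opposite elements. -/
theorem exists_reversing_factor (m p : ℕ) (h : p + m < n) : ∃ x z : DualBraid n,
    chain n p m = x * z ∧ 2 * length x ≤ m + 1 ∧ m ≤ 2 * length x ∧
    ∀ a : Fin n, (perm n x a : ℕ) = if p ≤ a ∧ (a : ℕ) ≤ p + m then 2 * p + m - a else a := by
  induction m using Nat.twoStepInduction generalizing p with
  | zero =>
    refine ⟨1, 1, by simp [chain], by simp, by simp, fun a => ?_⟩
    rw [map_one, Equiv.Perm.one_apply]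
    split_ifs <;> omega
  | one =>
    refine ⟨sigma n p (p + 1), 1, by simp [chain], ?_, ?_, fun a => ?_⟩
    · rw [length_sigma (by omega) (by omega)]
    · rw [length_sigma (by omega) (by omega)]; omega
    · rw [val_perm_sigma (by omega) (by omega)]
      split_ifs <;> omega
  | more m ih _ =>
    obtain ⟨x, z, hxz, hl, hl', hp⟩ := ih (p + 1) (by omega)
    refine ⟨sigma n p (p + m + 2) * x, z * sigma n p (p + m + 1), ?_, ?_, ?_, fun a => ?_⟩
    · rw [chain_succ_eq_sigma_mul (by omega), chain_succ_eq_mul_sigma (by omega), hxz]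
      simp only [mul_assoc]
      rfl
    · rw [length_mul, length_sigma (by omega) (by omega)]; omega
    · rw [length_mul, length_sigma (by omega) (by omega)]; omega
    · rw [map_mul, Equiv.Perm.mul_apply, val_perm_sigma (by omega) (by omega), hp]
      split_ifs <;> omega

end DualBraid

namespace DualBraid

open Module

variable {n : ℕ}

/-! ### Invariant functions of the underlying permutation -/

/-- The functions that are constant on the cycles of a permutation. -/
def invariants (w : Equiv.Perm (Fin n)) : Submodule ℚ (Fin n → ℚ) where
  carrier := {f | ∀ a, f (w a) = f a}
  add_mem' hf hg a := by simp [hf a, hg a]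
  zero_mem' _ := rfl
  smul_mem' c f hf a := by simp [hf a]

/-- The difference of the values at `a` and `b`. -/
def difference (a b : Fin n) : (Fin n → ℚ) →ₗ[ℚ] ℚ :=
  LinearMap.proj (R := ℚ) (φ := fun _ : Fin n => ℚ) a -
    LinearMap.proj (R := ℚ) (φ := fun _ : Fin n => ℚ) b

/-- The functions taking the same value at `a` and `b`. -/
def equalizer (a b : Fin n) : Submodule ℚ (Fin n → ℚ) :=
  LinearMap.ker (difference a b)

theorem mem_equalizer {a b : Fin n} {f : Fin n → ℚ} : f ∈ equalizer a b ↔ f a = f b := by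
  simp [equalizer, difference, sub_eq_zero]

theorem finrank_le_inf_equalizer (V : Submodule ℚ (Fin n → ℚ)) (a b : Fin n) :
    finrank ℚ V ≤ finrank ℚ ↥(V ⊓ equalizer a b) + 1 := by
  have h1 := Submodule.finrank_sup_add_finrank_inf_eq V (equalizer a b)
  have h2 := (V ⊔ equalizer a b).finrank_le
  have h3 := LinearMap.finrank_range_add_finrank_ker (difference a b)
  have h4 := (LinearMap.range (difference a b)).finrank_le
  rw [finrank_self] at h4
  change _ + finrank ℚ (equalizer a b) = _ at h3
  omega

theorem finrank_le_one_of_constant {V : Submodule ℚ (Fin n → ℚ)}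
    (h : ∀ f ∈ V, ∀ a b, f a = f b) : finrank ℚ V ≤ 1 := by
  have : V ≤ Submodule.span ℚ {fun _ => (1 : ℚ)} := by
    intro f hf
    rw [Submodule.mem_span_singleton]
    rcases isEmpty_or_nonempty (Fin n) with _ | ⟨⟨a⟩⟩
    · exact ⟨0, Subsingleton.elim _ _⟩
    · exact ⟨f a, funext fun b => by simpa using h f hf a b⟩
  exact (Submodule.finrank_mono this).trans ((finrank_span_le_card _).trans (by simp))

theorem invariants_inf_equalizer_le (p : DualIndex n) (x : DualBraid n) :
    invariants (perm n x) ⊓ equalizer p.1.1 p.1.2 ≤ invariants (perm n (gen p * x)) := by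
  rintro f ⟨hf, he⟩ a
  rw [SetLike.mem_coe, mem_equalizer] at he
  rw [← hf a, map_mul, perm_gen, Equiv.Perm.mul_apply, Equiv.swap_apply_def]
  split_ifs with h1 h2
  · rw [h1, he]
  · rw [h2, he]
  · rfl

theorem le_finrank_invariants (x : DualBraid n) :
    n ≤ finrank ℚ (invariants (perm n x)) + length x := by
  induction x using PresentedMonoid.induction_of_mul with
  | one =>
    have : invariants (perm n (1 : DualBraid n)) = ⊤ := by
      rw [eq_top_iff]; intro f _ a; simp
    rw [this, finrank_top]
    simp
  | of_mul p x ih =>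
    have h1 := finrank_le_inf_equalizer (invariants (perm n x)) p.1.1 p.1.2
    have h2 := Submodule.finrank_mono (invariants_inf_equalizer_le p x)
    have h3 : length (gen p * x) = 1 + length x := by rw [length_mul, length_gen]
    have h4 : finrank ℚ (invariants (perm n x)) ≤
      finrank ℚ (invariants (perm n (gen p * x))) + 1 := by omega
    calc n ≤ finrank ℚ (invariants (perm n x)) + length x := ih
      _ ≤ finrank ℚ (invariants (perm n (gen p * x))) + 1 + length x := by gcongr
      _ = _ := by rw [h3, add_assoc]

/-- A dual braid is reduced if its length is at most the absolute length of its permutation. -/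
def Reduced (x : DualBraid n) : Prop := finrank ℚ (invariants (perm n x)) + length x ≤ n

theorem Reduced.eq_of_mem_invariants {p : DualIndex n} {x : DualBraid n}
    (h : Reduced (gen p * x)) {f : Fin n → ℚ} (hf : f ∈ invariants (perm n (gen p * x))) :
    f p.1.1 = f p.1.2 := by
  have h1 := finrank_le_inf_equalizer (invariants (perm n x)) p.1.1 p.1.2
  have h2 := le_finrank_invariants x
  rw [Reduced, length_mul, length_gen] at h
  rw [← Submodule.eq_of_le_of_finrank_le (invariants_inf_equalizer_le p x) (by omega)] at hf
  exact mem_equalizer.mp hf.2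

theorem finrank_invariants_delta : finrank ℚ (invariants (perm n (delta n))) ≤ 1 := by
  refine finrank_le_one_of_constant fun f hf => ?_
  have : ∀ (k : ℕ) (hk : k < n), f ⟨k, hk⟩ = f ⟨0, by omega⟩ := by
    intro k
    induction k with
    | zero => intro; rfl
    | succ k ih =>
      intro hk
      rw [← ih (by omega), ← hf ⟨k, by omega⟩]
      congr 1
      ext
      rw [perm_delta_apply, if_pos (by simp; omega)]
  intro a b
  rw [← Fin.eta a a.isLt, ← Fin.eta b b.isLt, this, this b]

theorem finrank_add_finrank_le {x z : DualBraid n} (h : delta n = x * z) :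
    finrank ℚ (invariants (perm n x)) + finrank ℚ (invariants (perm n z)) ≤ n + 1 := by
  have h1 := Submodule.finrank_sup_add_finrank_inf_eq (invariants (perm n x)) (invariants (perm n z))
  have h2 := (invariants (perm n x) ⊔ invariants (perm n z)).finrank_le
  have h3 : invariants (perm n x) ⊓ invariants (perm n z) ≤ invariants (perm n (delta n)) := by
    rintro f ⟨hx, hz⟩ a
    rw [h, map_mul, Equiv.Perm.mul_apply, hx, hz]
  have h4 := Submodule.finrank_mono h3
  have h5 := finrank_invariants_delta (n := n)
  rw [finrank_fin_fun] at h2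
  omega

theorem reduced_left (hn : 0 < n) {x z : DualBraid n} (h : delta n = x * z) : Reduced x := by
  have h1 := finrank_add_finrank_le h
  have h2 := le_finrank_invariants z
  have h3 := length_delta hn
  rw [h, length_mul] at h3
  rw [Reduced]
  omega

theorem reduced_right (hn : 0 < n) {x z : DualBraid n} (h : delta n = x * z) : Reduced z := by
  have h1 := finrank_add_finrank_le h
  have h2 := le_finrank_invariants x
  have h3 := length_delta hn
  rw [h, length_mul] at h3
  rw [Reduced]
  omega

theorem eq_of_leftDvd (hn : 0 < n) {y : DualBraid n} (hy : y ∈ Garside.simples (delta n))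
    {p : DualIndex n} (hp : Garside.LeftDvd (gen p) y) {f : Fin n → ℚ}
    (hf : f ∈ invariants (perm n y)) : f p.1.1 = f p.1.2 := by
  obtain ⟨z, rfl⟩ := hp
  obtain ⟨z', hz'⟩ := hy
  exact (reduced_left hn hz').eq_of_mem_invariants hf

theorem eq_of_mul_gen_mem_simples (hn : 0 < n) {x : DualBraid n} {p : DualIndex n}
    (hp : x * gen p ∈ Garside.simples (delta n)) {f : Fin n → ℚ}
    (hf : f ∈ invariants ((perm n x)⁻¹ * perm n (delta n))) : f p.1.1 = f p.1.2 := by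
  obtain ⟨z, hz⟩ := hp
  rw [mul_assoc] at hz
  refine (reduced_right hn hz).eq_of_mem_invariants ?_
  rwa [hz, map_mul, inv_mul_cancel_left] at hf

/-! ### The Charney graph -/

/-- The vertices of the Charney graph of the dual braid monoid. -/
abbrev Vertex (n : ℕ) : Type :=
  {x : DualBraid n // x ∈ Garside.simples (delta n) \ {1, delta n}}

/-- A divisor of `δ` of intermediate length, as a vertex of the Charney graph. -/
def vertexOfFactor (hn : 0 < n) (x : DualBraid n) (hx : ∃ z, delta n = x * z) (h1 : 0 < length x)
    (h2 : length x < n - 1) : Vertex n :=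
  ⟨x, hx, by
    rintro (rfl | rfl)
    · simp at h1
    · rw [length_delta hn] at h2; omega⟩

/-- The vertex given by a generator. -/
def atom (hn : 3 ≤ n) (p : DualIndex n) : Vertex n :=
  vertexOfFactor (by omega) (gen p) (leftDvd_delta_gen p) (by simp) (by simp; omega)

theorem exists_coatom (hn : 3 ≤ n) (p : DualIndex n) : ∃ x : Vertex n, delta n = x.1 * gen p := by
  obtain ⟨x, hx⟩ := rightDvd_delta_gen p
  have := length_delta (n := n) (by omega)
  rw [hx, length_mul, length_gen] at this
  exact ⟨vertexOfFactor (by omega) x ⟨_, hx⟩ (by omega) (by omega), hx⟩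

/-- The vertex given by the complement of a generator. -/
noncomputable def coatom (hn : 3 ≤ n) (p : DualIndex n) : Vertex n := (exists_coatom hn p).choose

theorem delta_eq_coatom_mul (hn : 3 ≤ n) (p : DualIndex n) : delta n = (coatom hn p).1 * gen p :=
  (exists_coatom hn p).choose_spec

theorem adj_of_invariants (hn : 3 ≤ n) {x y : Vertex n} (f g : Fin n → ℚ)
    (hf : f ∈ invariants ((perm n x.1)⁻¹ * perm n (delta n))) (hg : g ∈ invariants (perm n y.1))
    (h : ∀ a b : Fin n, a < b → f a = f b → g a ≠ g b) : (charneyGraph n).Adj x y := by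
  rintro _ ⟨⟨p, rfl⟩, hp⟩
  exact ⟨⟨p, rfl⟩, fun hs => h _ _ p.2 (eq_of_mul_gen_mem_simples (by omega) hs hf)
    (eq_of_leftDvd (by omega) y.2.1 hp hg)⟩

/-- The function identifying the two elements of a pair, and injective otherwise. -/
def merge (p : DualIndex n) (a : Fin n) : ℚ :=
  if a = p.1.2 then ((p.1.1 : ℕ) : ℚ) else ((a : ℕ) : ℚ)

theorem merge_mem_invariants (p : DualIndex n) :
    merge p ∈ invariants (Equiv.swap p.1.1 p.1.2) := by
  intro a
  have := p.2.ne
  unfold merge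
  rw [Equiv.swap_apply_def]
  split_ifs <;> simp_all

theorem eq_of_merge_eq {p : DualIndex n} {a b : Fin n} (hab : a < b) (h : merge p a = merge p b) :
    p = ⟨(a, b), hab⟩ := by
  obtain ⟨⟨i, j⟩, hij⟩ := p
  simp only [merge] at h
  simp only [Subtype.mk.injEq, Prod.mk.injEq]
  split_ifs at h with h1 h2 <;> norm_cast at h <;> simp only [Fin.ext_iff, Fin.lt_def] at * <;> omega

theorem perm_atom (hn : 3 ≤ n) (p : DualIndex n) :
    perm n (atom hn p).1 = Equiv.swap p.1.1 p.1.2 := rfl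

theorem perm_coatom (hn : 3 ≤ n) (p : DualIndex n) :
    perm n (coatom hn p).1 = perm n (delta n) * Equiv.swap p.1.1 p.1.2 := by
  have h := congrArg (perm n) (delta_eq_coatom_mul hn p)
  rw [map_mul, perm_gen] at h
  rw [h, mul_assoc, Equiv.swap_mul_self, mul_one]

theorem perm_coatom_inv_mul (hn : 3 ≤ n) (p : DualIndex n) :
    (perm n (coatom hn p).1)⁻¹ * perm n (delta n) = Equiv.swap p.1.1 p.1.2 := by
  rw [perm_coatom, mul_inv_rev, inv_mul_cancel_right, Equiv.swap_inv]

theorem exists_adj_atom (hn : 3 ≤ n) (x : Vertex n) :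
    ∃ p, (charneyGraph n).Adj x (atom hn p) := by
  obtain ⟨p, hp⟩ : ∃ p, x.1 * gen p ∉ Garside.simples (delta n) := by
    by_contra! hc
    obtain ⟨z, hz⟩ := x.2.1
    have h1 : finrank ℚ (invariants (perm n z)) ≤ 1 := by
      refine finrank_le_one_of_constant fun f hf => ?_
      have hf' : f ∈ invariants ((perm n x.1)⁻¹ * perm n (delta n)) := by
        have h := congrArg (perm n) hz
        rw [map_mul] at h
        rwa [h, inv_mul_cancel_left]
      intro a b
      obtain h | h | h := lt_trichotomy a b
      · exact eq_of_mul_gen_mem_simples (by omega) (hc ⟨(a, b), h⟩) hf'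
      · rw [h]
      · exact (eq_of_mul_gen_mem_simples (by omega) (hc ⟨(b, a), h⟩) hf').symm
    have h2 := le_finrank_invariants z
    have h3 := length_delta (n := n) (by omega)
    rw [hz, length_mul] at h3
    exact x.2.2 (Or.inl (eq_one_of_length_eq_zero (by omega)))
  refine ⟨p, ?_⟩
  rintro _ ⟨⟨q, rfl⟩, z, hz⟩
  refine ⟨⟨q, rfl⟩, ?_⟩
  have hl : length (gen p) = length (gen q * z) := congrArg length hz
  rw [length_mul, length_gen, length_gen] at hl
  obtain rfl : z = 1 := eq_one_of_length_eq_zero (by omega)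
  rw [mul_one] at hz
  rw [← hz]
  exact hp

theorem exists_coatom_adj (hn : 3 ≤ n) (y : Vertex n) :
    ∃ p, (charneyGraph n).Adj (coatom hn p) y := by
  obtain ⟨p, hp⟩ : ∃ p, ¬ Garside.LeftDvd (gen p) y.1 := by
    by_contra! hc
    obtain ⟨z, hz⟩ := y.2.1
    have h1 : finrank ℚ (invariants (perm n y.1)) ≤ 1 := by
      refine finrank_le_one_of_constant fun f hf a b => ?_
      obtain h | h | h := lt_trichotomy a b
      · exact eq_of_leftDvd (by omega) y.2.1 (hc ⟨(a, b), h⟩) hf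
      · rw [h]
      · exact (eq_of_leftDvd (by omega) y.2.1 (hc ⟨(b, a), h⟩) hf).symm
    have h2 := le_finrank_invariants y.1
    have h3 := length_delta (n := n) (by omega)
    rw [hz, length_mul] at h3
    obtain rfl : z = 1 := eq_one_of_length_eq_zero (by omega)
    exact y.2.2 (Or.inr (hz.trans (mul_one _)).symm)
  refine ⟨p, ?_⟩
  rintro _ ⟨⟨q, rfl⟩, hq⟩
  refine ⟨⟨q, rfl⟩, fun hs => hp ?_⟩
  have := eq_of_merge_eq q.2 (eq_of_mul_gen_mem_simples (by omega) hs
    (f := merge p) (by rw [perm_coatom_inv_mul]; exact merge_mem_invariants p))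
  rw [this]
  exact hq

theorem val_swap_apply (i j a : Fin n) : (Equiv.swap i j a : ℕ) =
    if (a : ℕ) = i then (j : ℕ) else if (a : ℕ) = j then (i : ℕ) else a := by
  rw [Equiv.swap_apply_def]
  simp only [Fin.ext_iff]
  split_ifs <;> rfl

/-- The indicator function of the half-open interval `[i, j)`. -/
def indicatorIco (i j : ℕ) (a : Fin n) : ℚ := if i ≤ a ∧ (a : ℕ) < j then 1 else 0

theorem indicatorIco_eq_iff {i j : ℕ} {a b : Fin n} : indicatorIco i j a = indicatorIco i j b ↔
    ((i ≤ a ∧ (a : ℕ) < j) ↔ (i ≤ b ∧ (b : ℕ) < j)) := by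
  unfold indicatorIco
  split_ifs with h1 h2 h2 <;> simp [h1, h2]

theorem indicatorIco_mem_invariants_atom (hn : 3 ≤ n) (p : DualIndex n) :
    indicatorIco p.1.1 p.1.2 ∈ invariants ((perm n (atom hn p).1)⁻¹ * perm n (delta n)) := by
  intro a
  have h1 := val_swap_apply p.1.1 p.1.2 (perm n (delta n) a)
  have h2 := perm_delta_apply a
  have h3 := Fin.lt_def.mp p.2
  rw [indicatorIco_eq_iff, perm_atom, Equiv.swap_inv, Equiv.Perm.mul_apply]
  split_ifs at h1 h2 <;> omega

theorem indicatorIco_mem_invariants_coatom (hn : 3 ≤ n) (p : DualIndex n) :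
    indicatorIco (p.1.1 + 1) (p.1.2 + 1) ∈ invariants (perm n (coatom hn p).1) := by
  intro a
  have h1 := val_swap_apply p.1.1 p.1.2 a
  have h2 := perm_delta_apply (Equiv.swap p.1.1 p.1.2 a)
  have h3 := Fin.lt_def.mp p.2
  rw [indicatorIco_eq_iff, perm_coatom, Equiv.Perm.mul_apply]
  split_ifs at h1 h2 <;> omega

theorem atom_adj_atom (hn : 3 ≤ n) {p q : DualIndex n}
    (h : indicatorIco p.1.1 p.1.2 q.1.1 ≠ indicatorIco p.1.1 p.1.2 q.1.2) :
    (charneyGraph n).Adj (atom hn p) (atom hn q) := by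
  refine adj_of_invariants hn _ (merge q) (indicatorIco_mem_invariants_atom hn p)
    (by rw [perm_atom]; exact merge_mem_invariants q) fun a b hab hf hg => h ?_
  rw [eq_of_merge_eq hab hg]
  exact hf

theorem coatom_adj_coatom (hn : 3 ≤ n) {p q : DualIndex n}
    (h : indicatorIco (q.1.1 + 1) (q.1.2 + 1) p.1.1 ≠ indicatorIco (q.1.1 + 1) (q.1.2 + 1) p.1.2) :
    (charneyGraph n).Adj (coatom hn p) (coatom hn q) := by
  refine adj_of_invariants hn (merge p) _ (by rw [perm_coatom_inv_mul]; exact merge_mem_invariants p)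
    (indicatorIco_mem_invariants_coatom hn q) fun a b hab hf hg => h ?_
  rw [eq_of_merge_eq hab hf]
  exact hg

/-- The index of the generator `σ_{i,j}`, from natural numbers. -/
def index {n : ℕ} (i j : ℕ) (hij : i < j) (hj : j < n) : DualIndex n :=
  ⟨(⟨i, hij.trans hj⟩, ⟨j, hj⟩), hij⟩

theorem reflTransGen_of_index (r : DualIndex n → DualIndex n → Prop)
    (h_last : ∀ i j (hij : i < j) (hj : j < n),
      r (index i j hij hj) (index i (n - 1) (by omega) (by omega)))
    (h_pred : ∀ i (hi : i + 1 < n - 1),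
      r (index (i + 1) (n - 1) hi (by omega)) (index i (i + 1) (by omega) (by omega)))
    (h_zero : ∀ i (hi : i < n - 1),
      r (index 0 (n - 1) (by omega) (by omega)) (index i (n - 1) hi (by omega)))
    (h_join : ∀ i j (hij : i < j) (hj : j < n - 1),
      r (index j (n - 1) hj (by omega)) (index i j hij (by omega)))
    (p q : DualIndex n) : Relation.ReflTransGen r p q := by
  obtain ⟨⟨⟨i, hi⟩, ⟨j, hj⟩⟩, hij⟩ := p
  obtain ⟨⟨⟨k, hk⟩, ⟨l, hl⟩⟩, hkl⟩ := q
  change Relation.ReflTransGen r (index i j hij hj) (index k l hkl hl)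
  have hij' : i < j := hij
  have hkl' : k < l := hkl
  have down : ∀ i (hi : i < n - 1), Relation.ReflTransGen r (index i (n - 1) hi (by omega))
      (index 0 (n - 1) (by omega) (by omega)) := by
    intro i
    induction i with
    | zero => intro; exact .refl
    | succ i ih =>
      intro hi
      exact .head (h_pred i hi) (.head (h_last _ _ _ _) (ih (by omega)))
  refine .head (h_last _ _ _ _) ((down i (by omega)).trans ?_)
  by_cases h : l < n - 1
  · exact .head (h_zero l h) (.single (h_join k l hkl h))
  · obtain rfl : l = n - 1 := by omega
    exact .single (h_zero k hkl)

theorem reflTransGen_atom (hn : 3 ≤ n) (p q : DualIndex n) :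
    Relation.ReflTransGen (charneyGraph n).Adj (atom hn p) (atom hn q) := by
  refine Relation.ReflTransGen.lift (atom hn) (fun _ _ h => h) p q (reflTransGen_of_index
    (fun p q => (charneyGraph n).Adj (atom hn p) (atom hn q)) ?_ ?_ ?_ ?_ p q) <;>
  · intros
    refine atom_adj_atom hn ?_
    rw [Ne, indicatorIco_eq_iff]
    simp only [index]
    omega

theorem reflTransGen_coatom (hn : 3 ≤ n) (p q : DualIndex n) :
    Relation.ReflTransGen (charneyGraph n).Adj (coatom hn p) (coatom hn q) := by
  refine Relation.ReflTransGen.lift (coatom hn) (fun _ _ h => h) p q (reflTransGen_of_index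
    (fun p q => (charneyGraph n).Adj (coatom hn p) (coatom hn q)) ?_ ?_ ?_ ?_ p q) <;>
  · intros
    refine coatom_adj_coatom hn ?_
    rw [Ne, indicatorIco_eq_iff]
    simp only [index]
    omega

/-- Some generator is connected to some complement of a generator, through the vertex whose
permutation is the order reversal. -/
theorem exists_reflTransGen_atom_coatom (hn : 3 ≤ n) : ∃ p q,
    Relation.ReflTransGen (charneyGraph n).Adj (atom hn p) (coatom hn q) := by
  obtain ⟨x, z, hxz, hl, hl', hp⟩ := exists_reversing_factor (n := n) (n - 1) 0 (by omega)
  rw [← delta_eq_chain] at hxz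
  let v : Vertex n := vertexOfFactor (by omega) x ⟨z, hxz⟩ (by omega) (by omega)
  have hrev : perm n v.1 = Fin.revPerm := by
    ext a
    refine (hp a).trans ?_
    rw [Fin.revPerm_apply, Fin.val_rev]
    split_ifs <;> omega
  have hinv : (Fin.revPerm : Equiv.Perm (Fin n))⁻¹ = Fin.revPerm := rfl
  refine ⟨index 0 (n / 2) (by omega) (by omega), index (n / 2 - 1) (n - 1) (by omega) (by omega),
    .head (b := v) ?_ (.single ?_)⟩
  · refine adj_of_invariants hn _ (fun a => ((min (a : ℕ) (n - 1 - a) : ℕ) : ℚ))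
      (indicatorIco_mem_invariants_atom hn _) (fun a => ?_) fun a b hab hf hg => ?_
    · rw [hrev, Fin.revPerm_apply]
      simp only [Fin.val_rev, Nat.cast_inj]
      omega
    · rw [indicatorIco_eq_iff] at hf
      rw [Nat.cast_inj] at hg
      simp only [index] at hf
      rw [Fin.lt_def] at hab
      omega
  · refine adj_of_invariants hn
      (fun a => (((if (a : ℕ) = n - 1 then n else min (a : ℕ) (n - 2 - a)) : ℕ) : ℚ)) _
      (fun a => ?_) (indicatorIco_mem_invariants_coatom hn _) fun a b hab hf hg => ?_
    · have h2 := perm_delta_apply a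
      rw [hrev, hinv, Equiv.Perm.mul_apply, Fin.revPerm_apply]
      simp only [Fin.val_rev, Nat.cast_inj]
      split_ifs at h2 ⊢ <;> omega
    · rw [indicatorIco_eq_iff] at hg
      rw [Nat.cast_inj] at hf
      simp only [index] at hg
      rw [Fin.lt_def] at hab
      split_ifs at hf <;> omega

theorem stronglyConnected (hn : 3 ≤ n) : (charneyGraph n).StronglyConnected := by
  intro x y
  obtain ⟨p, hp⟩ := exists_adj_atom hn x
  obtain ⟨q, hq⟩ := exists_coatom_adj hn y
  obtain ⟨p', q', h⟩ := exists_reflTransGen_atom_coatom hn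
  exact .head hp ((reflTransGen_atom hn p p').trans
    (h.trans ((reflTransGen_coatom hn q' q).tail hq)))

theorem hasLoop (hn : 3 ≤ n) : (charneyGraph n).HasLoop := by
  refine ⟨atom hn (index 0 1 (by omega) (by omega)), atom_adj_atom hn ?_⟩
  rw [Ne, indicatorIco_eq_iff]
  simp [index]

end DualBraid

theorem proposition3p2 (n : ℕ) (hn : 3 ≤ n) :
    ((PositiveBraid.charneyGraph n).StronglyConnected ∧ (PositiveBraid.charneyGraph n).HasLoop) ∧
    ((DualBraid.charneyGraph n).StronglyConnected ∧ (DualBraid.charneyGraph n).HasLoop) :=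
  ⟨⟨PositiveBraid.stronglyConnected hn, PositiveBraid.hasLoop hn⟩,
    DualBraid.stronglyConnected hn, DualBraid.hasLoop hn⟩
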